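/- Let $D_0\subseteq\mathbb R^3$ be open and $T>0$. For $(x_0,t_0)\in\mathbb R^3\times\mathbb R$ let $D_-(x_0,t_0)=\{(x,t)\in\mathbb R^3\times\mathbb R : |x-x_0|\le t_0-t\}$ be the backward light cone, and let the domain of dependence $D(D_0)$ be the union of all cones $D_-(x_0,t_0)$ with $x_0\in\mathbb R^3$, $t_0\ge 0$ and $D_-(x_0,t_0)\cap\{t=0\}\subseteq D_0\times\{0\}$. Let $u=u(x,t)$ be a real function of class $C^2$ on $\mathbb R^3\times[0,T]$ (up to the boundary) such that $$u(x,0)=\varphi_0(x),\qquad u_t(x,0)=\varphi_1(x)\qquad\text{for all } x\in D_0 .$$ (a) If $u_{tt}-\Delta u\le 0$ on $\mathbb R^3\times(0,T)$ (equivalently, by continuity, on $\mathbb R^3\times[0,T]$), and $\varphi_0,\varphi_1\in C^2(D_0)$ are superharmonic in $D_0$, that is $\Delta\varphi_0\le 0$ and $\Delta\varphi_1\le 0$ in $D_0$, then $$u(x,t)\le \varphi_0(x)+t\,\varphi_1(x)\qquad\text{for all }(x,t)\in D(D_0)\text{ with }0\le t\le T .$$ (b) If $u_{tt}-\Delta u\ge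 0$ on $\mathbb R^3\times(0,T)$, and $\varphi_0,\varphi_1\in C^2(D_0)$ are subharmonic in $D_0$, that is $\Delta\varphi_0\ge 0$ and $\Delta\varphi_1\ge 0$ in $D_0$, then $$u(x,t)\ge \varphi_0(x)+t\,\varphi_1(x)\qquad\text{for all }(x,t)\in D(D_0)\text{ with }0\le t\le T .$$ -/

import Mathlib

noncomputable section

namespace WaveMax

/-- The Euclidean space `ℝⁿ`. -/
abbrev E (n : ℕ) : Type := EuclideanSpace ℝ (Fin n)

/-- The wave operator `L[u] = u_tt - Δ u`, with `Δ` acting in the space variable. -/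
def waveOp {n : ℕ} (u : E n → ℝ → ℝ) (x : E n) (t : ℝ) : ℝ :=
  iteratedDeriv 2 (fun s => u x s) t - Laplacian.laplacian (fun y => u y t) x

/-- The backward light cone `D_-(x₀, t₀)`. -/
def backwardCone {n : ℕ} (x₀ : E n) (t₀ : ℝ) : Set (E n × ℝ) :=
  {p | ‖p.1 - x₀‖ ≤ -(p.2 - t₀)}

/-- The dependence domain of `D₀`: the union of all the backward light cones with vertex
in `t ≥ 0` whose section by `{t = 0}` lies in `D₀`. -/
def dependenceDomain {n : ℕ} (D₀ : Set (E n)) : Set (E n × ℝ) :=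
  {p | ∃ (x₀ : E n) (t₀ : ℝ), 0 ≤ t₀ ∧
    (∀ y : E n, (y, (0 : ℝ)) ∈ backwardCone x₀ t₀ → y ∈ D₀) ∧ p ∈ backwardCone x₀ t₀}

/-- `φ` is of class `C²` and superharmonic in `D`, i.e. `Δ φ ≤ 0` there (`D` open). -/
def C2Superharmonic {n : ℕ} (φ : E n → ℝ) (D : Set (E n)) : Prop :=
  ContDiffOn ℝ 2 φ D ∧ ∀ x ∈ D, Laplacian.laplacian φ x ≤ 0

/-- `φ` is of class `C²` and subharmonic in `D`, i.e. `Δ φ ≥ 0` there (`D` open). -/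
def C2Subharmonic {n : ℕ} (φ : E n → ℝ) (D : Set (E n)) : Prop :=
  ContDiffOn ℝ 2 φ D ∧ ∀ x ∈ D, 0 ≤ Laplacian.laplacian φ x

/-- `u` takes the initial values `u(x,0) = φ₀(x)`, `u_t(x,0) = φ₁(x)` for `x ∈ D₀`; as `u` is
only considered for `0 ≤ t ≤ T`, the time derivative at `t = 0` is the one-sided one. -/
def HasInitialValues {n : ℕ} (T : ℝ) (u : E n → ℝ → ℝ) (φ₀ φ₁ : E n → ℝ)
    (D₀ : Set (E n)) : Prop :=
  ∀ x ∈ D₀, u x 0 = φ₀ x ∧ HasDerivWithinAt (fun t => u x t) (φ₁ x) (Set.Icc 0 T) 0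

end WaveMax

end

/-! Subtract the data: `v = u - φ₀ - t φ₁` has zero Cauchy data on `D₀`, and superharmonicity gives
`v_tt - Δv ≤ 0` for `0 < t < T`. It remains to show `v ≤ 0` at the vertex `(x, t)` of a backward
cone with base in `D₀`.

Let `G(ρ)` be the integral over unit vectors `ω` of `v + ρ (∂_s + ∂_r) v` at `(x + ρω, t - ρ)`. Then
`G(0)` is a positive multiple of `v(x, t)`, and `G(t) = 0` by the data. Differentiating along the
characteristic gives `G' = ∫ (2 v_r + ρ (v_rr - v_ss))`. In dimension 3, Darboux's formula
(`integral_laplacian_eq_radial`) turns this into `ρ ∫ (Δv - v_ss) ≥ 0`, so `G(0) ≤ G(t) = 0`.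

Darboux's formula comes from rotation invariance alone: rotational derivatives integrate to zero
over the sphere, and the squares of the three coordinate rotation fields add up to the spherical
Laplacian. Part (b) is part (a) for `-u`. -/

noncomputable section

namespace WaveMax

open MeasureTheory Set Filter Topology

/-! ### Integrals depending on a parameter -/

section ParametricIntegrals

variable {X : Type*} [TopologicalSpace X] [T2Space X] [MeasurableSpace X] [BorelSpace X]
  {μ : Measure X} [IsFiniteMeasure μ] {K : Set X}

/-- A function continuous on a compact set carrying a finite measure is integrable. -/
theorem integrable_of_continuousOn_of_ae_mem (hK : IsCompact K) (hμ : ∀ᵐ ω ∂μ, ω ∈ K)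
    {f : X → ℝ} (hf : ContinuousOn f K) : Integrable f μ := by
  have h := hf.integrableOn_compact (μ := μ) hK
  rwa [IntegrableOn, Measure.restrict_eq_self_of_ae_mem hμ] at h

theorem continuousOn_integral_of_isCompact (hK : IsCompact K) (hμ : ∀ᵐ ω ∂μ, ω ∈ K)
    {I : Set ℝ} (hI : IsCompact I) {F : ℝ → X → ℝ}
    (hF : ContinuousOn (fun q : ℝ × X => F q.1 q.2) (I ×ˢ K)) :
    ContinuousOn (fun ρ => ∫ ω, F ρ ω ∂μ) I := by
  obtain ⟨C, hC⟩ := (hI.prod hK).exists_bound_of_continuousOn hF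
  refine continuousOn_of_dominated (bound := fun _ => C) ?_ ?_ (integrable_const C) ?_
  · intro ρ hρ
    exact (integrable_of_continuousOn_of_ae_mem hK hμ
      (hF.comp (by fun_prop : ContinuousOn (fun ω : X => (ρ, ω)) K)
        fun ω hω => ⟨hρ, hω⟩)).aestronglyMeasurable
  · intro ρ hρ
    filter_upwards [hμ] with ω hω using hC (ρ, ω) ⟨hρ, hω⟩
  · filter_upwards [hμ] with ω hω
    exact hF.comp (by fun_prop : ContinuousOn (fun ρ : ℝ => (ρ, ω)) I) fun ρ hρ => ⟨hρ, hω⟩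

/-- Differentiation under the integral sign for a finite measure carried by a compact set. -/
theorem hasDerivAt_integral_of_isCompact (hK : IsCompact K) (hμ : ∀ᵐ ω ∂μ, ω ∈ K)
    {I : Set ℝ} {F F' : ℝ → X → ℝ} {ρ₀ : ℝ} (hI : I ∈ 𝓝 ρ₀)
    (hF : ∀ ρ ∈ I, ContinuousOn (F ρ) K)
    (hF' : ContinuousOn (fun q : ℝ × X => F' q.1 q.2) (I ×ˢ K))
    (hd : ∀ ρ ∈ I, ∀ ω ∈ K, HasDerivAt (fun r => F r ω) (F' ρ ω) ρ) :
    HasDerivAt (fun ρ => ∫ ω, F ρ ω ∂μ) (∫ ω, F' ρ₀ ω ∂μ) ρ₀ := by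
  -- `I` need not be compact, so the dominating constant is taken on a closed ball inside it.
  obtain ⟨ε, hε, hεI⟩ := Metric.nhds_basis_closedBall.mem_iff.1 hI
  obtain ⟨C, hC⟩ := ((isCompact_closedBall ρ₀ ε).prod hK).exists_bound_of_continuousOn
    (hF'.mono (prod_mono hεI Subset.rfl))
  have hρ₀ : ρ₀ ∈ I := mem_of_mem_nhds hI
  refine (hasDerivAt_integral_of_dominated_loc_of_deriv_le (bound := fun _ => C)
    (Metric.closedBall_mem_nhds ρ₀ hε) ?_ ?_ ?_ ?_ (integrable_const C) ?_).2
  · filter_upwards [hI] with ρ hρ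
    exact (integrable_of_continuousOn_of_ae_mem hK hμ (hF ρ hρ)).aestronglyMeasurable
  · exact integrable_of_continuousOn_of_ae_mem hK hμ (hF ρ₀ hρ₀)
  · exact (integrable_of_continuousOn_of_ae_mem hK hμ
      (hF'.comp (by fun_prop : ContinuousOn (fun ω : X => (ρ₀, ω)) K)
        fun ω hω => ⟨hρ₀, hω⟩)).aestronglyMeasurable
  · filter_upwards [hμ] with ω hω ρ hρ using hC (ρ, ω) ⟨hρ, hω⟩
  · filter_upwards [hμ] with ω hω ρ hρ using hd ρ (hεI hρ) ω hω

end ParametricIntegrals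

/-! ### Rotation-invariant measure on the unit sphere -/

section SphereMeasure

variable {n : ℕ}

/-- The (unnormalized) rotation invariant measure on the unit sphere of `ℝⁿ`, as a measure on
`ℝⁿ`: the image of Lebesgue measure on the punctured unit ball under radial projection. -/
def sphereMeasure (n : ℕ) : Measure (E n) :=
  (volume.restrict (Metric.ball (0 : E n) 1 \ {0})).map fun y => ‖y‖⁻¹ • y

theorem measurable_radialProjection : Measurable fun y : E n => ‖y‖⁻¹ • y := by fun_prop

instance : IsFiniteMeasure (sphereMeasure n) := by
  have : IsFiniteMeasure (volume.restrict (Metric.ball (0 : E n) 1 \ {0})) :=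
    ⟨by
      rw [Measure.restrict_apply_univ]
      exact (measure_mono sdiff_subset).trans_lt measure_ball_lt_top⟩
  unfold sphereMeasure
  infer_instance

theorem ae_mem_sphere : ∀ᵐ ω ∂(sphereMeasure n), ω ∈ Metric.sphere (0 : E n) 1 := by
  rw [sphereMeasure]
  refine (ae_map_iff (p := fun ω => ω ∈ Metric.sphere (0 : E n) 1)
    measurable_radialProjection.aemeasurable Metric.isClosed_sphere.measurableSet).2 ?_
  filter_upwards [ae_restrict_mem (measurableSet_ball.diff (measurableSet_singleton 0))] with y hy
  have : ‖y‖ ≠ 0 := by simpa using hy.2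
  simp [norm_smul, this]

/-- The total mass is the volume of the unit ball, the origin being a null set. For `n = 0` the
punctured ball is empty and the mass is zero. -/
theorem sphereMeasure_real_univ_pos (hn : 0 < n) : 0 < (sphereMeasure n).real univ := by
  have : Nonempty (Fin n) := ⟨⟨0, hn⟩⟩
  rw [measureReal_def, ENNReal.toReal_pos_iff]
  refine ⟨?_, measure_lt_top _ _⟩
  rw [sphereMeasure, Measure.map_apply measurable_radialProjection MeasurableSet.univ,
    preimage_univ, Measure.restrict_apply_univ, measure_sdiff_null (by simp)]
  exact Metric.measure_ball_pos _ _ one_pos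

/-- A linear isometry preserves Lebesgue measure and the punctured ball, and commutes with radial
projection. -/
theorem integral_sphereMeasure_comp (R : E n ≃ₗᵢ[ℝ] E n) (f : E n → ℝ) :
    ∫ ω, f (R ω) ∂(sphereMeasure n) = ∫ ω, f ω ∂(sphereMeasure n) := by
  have h : (sphereMeasure n).map R = sphereMeasure n := by
    have hR : Measurable R := R.continuous.measurable
    rw [sphereMeasure, Measure.map_map hR measurable_radialProjection]
    have h1 : (R ∘ fun y : E n => ‖y‖⁻¹ • y) = (fun y : E n => ‖y‖⁻¹ • y) ∘ R := by
      ext1 y; simp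
    have h2 := (R.measurePreserving.restrict_preimage
      (s := Metric.ball (0 : E n) 1 \ {0})
      (measurableSet_ball.diff (measurableSet_singleton 0))).map_eq
    have h3 : R ⁻¹' (Metric.ball (0 : E n) 1 \ {0}) = Metric.ball (0 : E n) 1 \ {0} := by
      ext y; simp
    rw [h3] at h2
    rw [h1, ← Measure.map_map measurable_radialProjection hR, h2]
  conv_rhs => rw [← h]
  -- `R` is a homeomorphism, so no measurability of `f` is needed.
  exact (integral_map_equiv R.toHomeomorph.toMeasurableEquiv f).symm

/-- The generator `ω ↦ ⟪a, ω⟫ b - ⟪b, ω⟫ a` of the rotations in the plane spanned by `a`, `b`. -/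
def rotationGenerator (a b : E n) : E n →L[ℝ] E n :=
  (innerSL ℝ a).smulRight b - (innerSL ℝ b).smulRight a

theorem rotationGenerator_apply (a b y : E n) :
    rotationGenerator a b y = inner ℝ a y • b - inner ℝ b y • a := rfl

/-- The rotation by the angle `θ` in the plane spanned by `a`, `b`, as a linear map. -/
def planeRotationMap (a b : E n) (θ : ℝ) : E n →L[ℝ] E n :=
  ContinuousLinearMap.id ℝ (E n)
    + (Real.cos θ - 1) • ((innerSL ℝ a).smulRight a + (innerSL ℝ b).smulRight b)
    + Real.sin θ • rotationGenerator a b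

theorem planeRotationMap_apply (a b : E n) (θ : ℝ) (y : E n) :
    planeRotationMap a b θ y = y + (Real.cos θ - 1) • (inner ℝ a y • a + inner ℝ b y • b)
      + Real.sin θ • (inner ℝ a y • b - inner ℝ b y • a) := rfl

theorem norm_planeRotationMap {a b : E n} (ha : ‖a‖ = 1) (hb : ‖b‖ = 1) (hab : inner ℝ a b = 0)
    (θ : ℝ) (y : E n) : ‖planeRotationMap a b θ y‖ = ‖y‖ := by
  have hba : inner ℝ b a = 0 := by rw [real_inner_comm]; exact hab
  have haa : inner ℝ a a = 1 := by rw [real_inner_self_eq_norm_sq, ha]; norm_num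
  have hbb : inner ℝ b b = 1 := by rw [real_inner_self_eq_norm_sq, hb]; norm_num
  rw [← sq_eq_sq₀ (norm_nonneg _) (norm_nonneg _), ← real_inner_self_eq_norm_sq,
    ← real_inner_self_eq_norm_sq, planeRotationMap_apply]
  simp only [inner_add_left, inner_add_right, inner_sub_left, inner_sub_right, inner_smul_left,
    inner_smul_right, haa, hbb, hab, hba, real_inner_comm a y, real_inner_comm b y,
    RCLike.conj_to_real]
  -- The squared norm changes by `(cos² θ + sin² θ - 1)` times the squared norm of the projection of
  -- `y` to the plane.
  linear_combination (inner ℝ a y ^ 2 + inner ℝ b y ^ 2) * Real.sin_sq_add_cos_sq θ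

/-- The rotation by the angle `θ` in the plane spanned by the orthonormal vectors `a`, `b`. -/
def planeRotation {a b : E n} (ha : ‖a‖ = 1) (hb : ‖b‖ = 1) (hab : inner ℝ a b = 0) (θ : ℝ) :
    E n ≃ₗᵢ[ℝ] E n :=
  LinearIsometry.toLinearIsometryEquiv
    ⟨(planeRotationMap a b θ : E n →ₗ[ℝ] E n), norm_planeRotationMap ha hb hab θ⟩ rfl

/-- Derivative of the rotation; at every angle it is the generator applied to the rotated
vector. -/
theorem hasDerivAt_planeRotationMap {a b : E n} (ha : ‖a‖ = 1) (hb : ‖b‖ = 1)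
    (hab : inner ℝ a b = 0) (θ : ℝ) (y : E n) :
    HasDerivAt (fun θ => planeRotationMap a b θ y)
      (rotationGenerator a b (planeRotationMap a b θ y)) θ := by
  have hba : inner ℝ b a = 0 := by rw [real_inner_comm]; exact hab
  have haa : inner ℝ a a = 1 := by rw [real_inner_self_eq_norm_sq, ha]; norm_num
  have hbb : inner ℝ b b = 1 := by rw [real_inner_self_eq_norm_sq, hb]; norm_num
  have h1 := ((Real.hasDerivAt_cos θ).sub_const 1).smul_const (inner ℝ a y • a + inner ℝ b y • b)
  have h2 := (Real.hasDerivAt_sin θ).smul_const (inner ℝ a y • b - inner ℝ b y • a)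
  have h3 := ((hasDerivAt_const θ y).add h1).add h2
  refine h3.congr_deriv ?_
  simp only [planeRotationMap_apply, rotationGenerator_apply, inner_add_right, inner_sub_right,
    inner_smul_right, haa, hbb, hab, hba]
  module

/-- The integral over the sphere of a rotational derivative vanishes. -/
theorem integral_rotationGenerator_eq_zero {a b : E n} (ha : ‖a‖ = 1) (hb : ‖b‖ = 1)
    (hab : inner ℝ a b = 0) {U : Set (E n)} (hU : IsOpen U) (hKU : Metric.sphere 0 1 ⊆ U)
    {g : E n → ℝ} (hg : ContDiffOn ℝ 1 g U) :
    ∫ ω, fderiv ℝ g ω (rotationGenerator a b ω) ∂(sphereMeasure n) = 0 := by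
  have hmem : ∀ θ, ∀ ω ∈ Metric.sphere (0 : E n) 1,
      planeRotationMap a b θ ω ∈ Metric.sphere (0 : E n) 1 := by
    intro θ ω hω
    simpa [norm_planeRotationMap ha hb hab] using hω
  have hcont : Continuous fun q : ℝ × E n => planeRotationMap a b q.1 q.2 := by
    simp only [planeRotationMap_apply]
    fun_prop
  have hfd : ContinuousOn (fderiv ℝ g) U := hg.continuousOn_fderiv_of_isOpen hU le_rfl
  -- Differentiate the integral of `g` over the rotated sphere at angle `0`. By invariance that
  -- integral is constant, so its derivative vanishes.
  have key := hasDerivAt_integral_of_isCompact (μ := sphereMeasure n) (isCompact_sphere 0 1)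
    ae_mem_sphere (I := univ) (ρ₀ := 0) univ_mem
    (F := fun θ ω => g (planeRotationMap a b θ ω))
    (F' := fun θ ω => fderiv ℝ g (planeRotationMap a b θ ω)
      (rotationGenerator a b (planeRotationMap a b θ ω)))
    (fun θ _ => hg.continuousOn.comp (planeRotationMap a b θ).continuous.continuousOn
      fun ω hω => hKU (hmem θ ω hω))
    (ContinuousOn.clm_apply
      (hfd.comp hcont.continuousOn fun q hq => hKU (hmem q.1 q.2 hq.2))
      ((rotationGenerator a b).continuous.comp hcont).continuousOn)
    (fun θ _ ω hω => by
      have hd : HasFDerivAt g (fderiv ℝ g (planeRotationMap a b θ ω)) (planeRotationMap a b θ ω) :=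
        ((hg.contDiffAt (hU.mem_nhds (hKU (hmem θ ω hω)))).differentiableAt
          one_ne_zero).hasFDerivAt
      exact hd.comp_hasDerivAt θ (hasDerivAt_planeRotationMap ha hb hab θ ω))
  have hconst : (fun θ => ∫ ω, g (planeRotationMap a b θ ω) ∂(sphereMeasure n)) =
      fun _ => ∫ ω, g ω ∂(sphereMeasure n) := by
    ext θ
    exact integral_sphereMeasure_comp (planeRotation ha hb hab θ) g
  rw [hconst] at key
  have h0 := key.unique (hasDerivAt_const (0 : ℝ) _)
  simpa [planeRotationMap_apply] using h0

end SphereMeasure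

/-! ### The wave operator through second Fréchet derivatives -/

section SecondDerivatives

/-- Second derivative of the composition with an affine map. -/
theorem fderiv_fderiv_comp_affine {F G : Type*} [NormedAddCommGroup F] [NormedSpace ℝ F]
    [NormedAddCommGroup G] [NormedSpace ℝ G] {f : G → ℝ} (L : F →L[ℝ] G) (c : G) {y : F}
    (hf : ContDiffAt ℝ 2 f (c + L y)) (v w : F) :
    fderiv ℝ (fderiv ℝ fun z => f (c + L z)) y v w =
      fderiv ℝ (fderiv ℝ f) (c + L y) (L v) (L w) := by
  have hA : ∀ z, HasFDerivAt (fun z => c + L z) L z := fun z => L.hasFDerivAt.const_add c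
  -- The first-derivative formula must hold near `y`, not only at `y`, to be differentiated again.
  have hev : ∀ᶠ z in 𝓝 y, ContDiffAt ℝ 2 f (c + L z) :=
    (hA y).continuousAt.eventually (hf.eventually (by simp))
  have h1 : fderiv ℝ (fun z => f (c + L z)) =ᶠ[𝓝 y] fun z => (fderiv ℝ f (c + L z)).comp L := by
    filter_upwards [hev] with z hz
    exact ((hz.differentiableAt two_ne_zero).hasFDerivAt.comp z (hA z)).fderiv
  rw [h1.fderiv_eq]
  have h2 : HasFDerivAt (fderiv ℝ f) (fderiv ℝ (fderiv ℝ f) (c + L y)) (c + L y) :=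
    ((hf.fderiv_right (m := 1) (by norm_num)).differentiableAt one_ne_zero).hasFDerivAt
  have h3 := (h2.comp y (hA y)).clm_comp (hasFDerivAt_const L y)
  have h4 : fderiv ℝ (fun z => (fderiv ℝ f (c + L z)).comp L) y = _ := h3.fderiv
  rw [h4]
  simp

/-- The wave operator in terms of the second derivative on space-time. -/
theorem waveOp_eq_fderiv_fderiv {n : ℕ} {u : E n → ℝ → ℝ} {x : E n} {t : ℝ}
    (hu : ContDiffAt ℝ 2 (fun p : E n × ℝ => u p.1 p.2) (x, t)) :
    waveOp u x t =
      fderiv ℝ (fderiv ℝ fun p : E n × ℝ => u p.1 p.2) (x, t) (0, 1) (0, 1)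
      - ∑ i, fderiv ℝ (fderiv ℝ fun p : E n × ℝ => u p.1 p.2) (x, t)
          (EuclideanSpace.single i 1, 0) (EuclideanSpace.single i 1, 0) := by
  unfold waveOp
  congr 1
  · have h := fderiv_fderiv_comp_affine (ContinuousLinearMap.inr ℝ (E n) ℝ) ((x, 0) : E n × ℝ)
      (y := t) (f := fun p : E n × ℝ => u p.1 p.2) (by simpa using hu) 1 1
    simp only [ContinuousLinearMap.inr_apply, Prod.mk_add_mk, add_zero, zero_add] at h
    rw [← h, iteratedDeriv_eq_iteratedFDeriv, iteratedFDeriv_two_apply]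
  · rw [InnerProductSpace.laplacian_eq_iteratedFDeriv_orthonormalBasis _
      (EuclideanSpace.basisFun (Fin n) ℝ)]
    refine Finset.sum_congr rfl fun i _ => ?_
    have h := fderiv_fderiv_comp_affine (ContinuousLinearMap.inl ℝ (E n) ℝ) ((0, t) : E n × ℝ)
      (y := x) (f := fun p : E n × ℝ => u p.1 p.2) (by simpa using hu)
      (EuclideanSpace.single i 1) (EuclideanSpace.single i 1)
    simp only [ContinuousLinearMap.inl_apply, Prod.mk_add_mk, add_zero, zero_add] at h
    rw [← h, iteratedFDeriv_two_apply]
    simp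

end SecondDerivatives

/-! ### Darboux's formula and derivatives along characteristics -/

section SphericalMeans

/-- For a symmetric bilinear form `B` and a linear form `ℓ` on `ℝ³`, the sum over the three
coordinate planes of the second order rotational derivatives. -/
theorem sum_rotationGenerator (B : E 3 →L[ℝ] E 3 →L[ℝ] ℝ) (hB : ∀ v w, B v w = B w v)
    (ℓ : E 3 →L[ℝ] ℝ) {e : Fin 3 → E 3} (he : ∀ i, e i = EuclideanSpace.single i 1)
    {ω : E 3} (hω : ω ∈ Metric.sphere (0 : E 3) 1) (ρ : ℝ) :
    (ρ * B (rotationGenerator (e 0) (e 1) ω) (rotationGenerator (e 0) (e 1) ω)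
        + ℓ (rotationGenerator (e 0) (e 1) (rotationGenerator (e 0) (e 1) ω)))
      + (ρ * B (rotationGenerator (e 1) (e 2) ω) (rotationGenerator (e 1) (e 2) ω)
        + ℓ (rotationGenerator (e 1) (e 2) (rotationGenerator (e 1) (e 2) ω)))
      + (ρ * B (rotationGenerator (e 0) (e 2) ω) (rotationGenerator (e 0) (e 2) ω)
        + ℓ (rotationGenerator (e 0) (e 2) (rotationGenerator (e 0) (e 2) ω)))
      = ρ * (∑ i, B (e i) (e i) - B ω ω) - 2 * ℓ ω := by
  have hin : ∀ i (y : E 3), inner ℝ (e i) y = y i := by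
    intro i y; simp [he, EuclideanSpace.inner_single_left]
  have hee : ∀ i j, (e i) j = if j = i then 1 else 0 := by
    intro i j; simp [he]
  have hnorm : ω 0 ^ 2 + ω 1 ^ 2 + ω 2 ^ 2 = 1 := by
    have h : ‖ω‖ = 1 := by simpa using hω
    have h2 := EuclideanSpace.real_norm_sq_eq ω
    rw [h, Fin.sum_univ_three] at h2
    linarith
  have hexp : ω = ω 0 • e 0 + ω 1 • e 1 + ω 2 • e 2 := by
    ext i
    fin_cases i <;> simp [hee]
  have hBω : B ω ω = B (ω 0 • e 0 + ω 1 • e 1 + ω 2 • e 2) (ω 0 • e 0 + ω 1 • e 1 + ω 2 • e 2) :=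
    by rw [← hexp]
  have hℓω : ℓ ω = ℓ (ω 0 • e 0 + ω 1 • e 1 + ω 2 • e 2) := by rw [← hexp]
  rw [hBω, hℓω]
  simp only [rotationGenerator_apply, hin, map_add, map_sub, map_smul, smul_eq_mul,
    add_apply, sub_apply, smul_apply,
    Fin.sum_univ_three, hee, hB (e 1) (e 0), hB (e 2) (e 0),
    hB (e 2) (e 1)]
  simp
  -- For the three fields `A`, the sum of `Aω ⊗ Aω` is `|ω|² I - ω ⊗ ω` and the sum of `A²ω` is
  -- `-2ω`. Only the trace term uses `|ω| = 1`.
  linear_combination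
    ρ * (B (e 0) (e 0) + B (e 1) (e 1) + B (e 2) (e 2)) * hnorm

variable {Ω : Set (E 3 × ℝ)} {V : E 3 × ℝ → ℝ}

theorem contDiffOn_fderiv_of_isOpen (hΩ : IsOpen Ω) (hV : ContDiffOn ℝ 2 V Ω) :
    ContDiffOn ℝ 1 (fderiv ℝ V) Ω :=
  hV.fderiv_of_isOpen hΩ (by norm_num)

theorem continuousOn_fderiv_fderiv (hΩ : IsOpen Ω) (hV : ContDiffOn ℝ 2 V Ω) :
    ContinuousOn (fderiv ℝ (fderiv ℝ V)) Ω :=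
  (contDiffOn_fderiv_of_isOpen hΩ hV).continuousOn_fderiv_of_isOpen hΩ le_rfl

theorem hasFDerivAt_fderiv (hΩ : IsOpen Ω) (hV : ContDiffOn ℝ 2 V Ω) {p : E 3 × ℝ} (hp : p ∈ Ω) :
    HasFDerivAt (fderiv ℝ V) (fderiv ℝ (fderiv ℝ V) p) p :=
  (((contDiffOn_fderiv_of_isOpen hΩ hV).contDiffAt (hΩ.mem_nhds hp)).differentiableAt
    one_ne_zero).hasFDerivAt

/-- Second order rotational derivatives integrate to zero over a sphere in a time slice. -/
theorem integral_second_rotational_derivative_eq_zero (hΩ : IsOpen Ω) (hV : ContDiffOn ℝ 2 V Ω)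
    {x : E 3} {ρ s : ℝ} (hs : ∀ ω ∈ Metric.sphere (0 : E 3) 1, (x + ρ • ω, s) ∈ Ω)
    {a b : E 3} (ha : ‖a‖ = 1) (hb : ‖b‖ = 1) (hab : inner ℝ a b = 0) :
    ∫ ω, (ρ * fderiv ℝ (fderiv ℝ V) (x + ρ • ω, s)
        (rotationGenerator a b ω, 0) (rotationGenerator a b ω, 0)
      + fderiv ℝ V (x + ρ • ω, s) (rotationGenerator a b (rotationGenerator a b ω), 0))
      ∂(sphereMeasure 3) = 0 := by
  set A := rotationGenerator a b
  have hpt : ContDiff ℝ 1 fun y : E 3 => (x + ρ • y, s) := by fun_prop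
  have hU : IsOpen ((fun y : E 3 => (x + ρ • y, s)) ⁻¹' Ω) := hΩ.preimage hpt.continuous
  -- This is the rotational derivative of `y ↦ V (x + ρ y, s)` without its factor `ρ`. It is `C¹`,
  -- and its own derivative along `A` is the integrand.
  have hg : ContDiffOn ℝ 1 (fun y : E 3 => fderiv ℝ V (x + ρ • y, s) (A y, 0))
      ((fun y : E 3 => (x + ρ • y, s)) ⁻¹' Ω) := by
    refine ContDiffOn.clm_apply ?_ (by fun_prop)
    exact (contDiffOn_fderiv_of_isOpen hΩ hV).comp hpt.contDiffOn fun y hy => hy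
  refine (integral_congr_ae ?_).trans (integral_rotationGenerator_eq_zero ha hb hab hU hs hg)
  filter_upwards [ae_mem_sphere] with ω hω
  have hp : HasFDerivAt (fun y : E 3 => (x + ρ • y, s))
      ((ρ • ContinuousLinearMap.id ℝ (E 3)).prod 0) ω :=
    (((hasFDerivAt_id ω).const_smul ρ).const_add x).prodMk (hasFDerivAt_const s ω)
  have hA : HasFDerivAt (fun y : E 3 => (A y, (0 : ℝ))) (A.prod 0) ω :=
    A.hasFDerivAt.prodMk (hasFDerivAt_const 0 ω)
  have h := ((hasFDerivAt_fderiv hΩ hV (hs ω hω)).comp ω hp).clm_apply hA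
  have h' : fderiv ℝ (fun y : E 3 => fderiv ℝ V (x + ρ • y, s) (A y, 0)) ω = _ := h.fderiv
  rw [h']
  have hsm : ((ρ • A ω, (0 : ℝ)) : E 3 × ℝ) = ρ • (A ω, 0) := by simp
  change _ = fderiv ℝ V (x + ρ • ω, s) (A (A ω), 0)
    + fderiv ℝ (fderiv ℝ V) (x + ρ • ω, s) (ρ • A ω, 0) (A ω, 0)
  rw [hsm, map_smul, smul_apply, smul_eq_mul, add_comm]

theorem continuousOn_second_rotational_derivative (hΩ : IsOpen Ω) (hV : ContDiffOn ℝ 2 V Ω)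
    {x : E 3} {ρ s : ℝ} (hs : ∀ ω ∈ Metric.sphere (0 : E 3) 1, (x + ρ • ω, s) ∈ Ω) (a b : E 3) :
    ContinuousOn (fun ω => ρ * fderiv ℝ (fderiv ℝ V) (x + ρ • ω, s)
        (rotationGenerator a b ω, 0) (rotationGenerator a b ω, 0)
      + fderiv ℝ V (x + ρ • ω, s) (rotationGenerator a b (rotationGenerator a b ω), 0))
      (Metric.sphere (0 : E 3) 1) := by
  have hpt : ContinuousOn (fun y : E 3 => (x + ρ • y, s)) (Metric.sphere (0 : E 3) 1) := by
    fun_prop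
  have h1 := (contDiffOn_fderiv_of_isOpen hΩ hV).continuousOn.comp hpt hs
  have h2 := (continuousOn_fderiv_fderiv hΩ hV).comp hpt hs
  exact (continuousOn_const.mul ((h2.clm_apply (by fun_prop)).clm_apply (by fun_prop))).add
    (h1.clm_apply (by fun_prop))

/-- Darboux's formula: on a sphere of radius `ρ` the mean of `ρ Δ V` is the mean of
`ρ V_rr + 2 V_r`. -/
theorem integral_laplacian_eq_radial (hΩ : IsOpen Ω) (hV : ContDiffOn ℝ 2 V Ω)
    {x : E 3} {ρ s : ℝ} (hs : ∀ ω ∈ Metric.sphere (0 : E 3) 1, (x + ρ • ω, s) ∈ Ω) :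
    ∫ ω, (ρ * (∑ i, fderiv ℝ (fderiv ℝ V) (x + ρ • ω, s)
          (EuclideanSpace.single i 1, 0) (EuclideanSpace.single i 1, 0)
        - fderiv ℝ (fderiv ℝ V) (x + ρ • ω, s) (ω, 0) (ω, 0))
      - 2 * fderiv ℝ V (x + ρ • ω, s) (ω, 0)) ∂(sphereMeasure 3) = 0 := by
  set e : Fin 3 → E 3 := fun i => EuclideanSpace.single i 1 with he
  have hnorm : ∀ i, ‖e i‖ = 1 := fun i => by simp [he]
  have horth : ∀ i j, i ≠ j → inner ℝ (e i) (e j) = 0 := fun i j hij => by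
    simp [he, EuclideanSpace.inner_single_left, hij]
  have hz := fun i j (hij : i ≠ j) =>
    integral_second_rotational_derivative_eq_zero hΩ hV hs (hnorm i) (hnorm j) (horth i j hij)
  have hi := fun i j => integrable_of_continuousOn_of_ae_mem (isCompact_sphere (0 : E 3) 1)
    ae_mem_sphere (continuousOn_second_rotational_derivative hΩ hV hs (e i) (e j))
  have hsum := integral_add ((hi 0 1).add (hi 1 2)) (hi 0 2)
  have hsum' := integral_add (hi 0 1) (hi 1 2)
  simp only [Pi.add_apply] at hsum
  rw [hsum', hz 0 1 (by decide), hz 1 2 (by decide), hz 0 2 (by decide)] at hsum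
  simp only [add_zero] at hsum
  refine (integral_congr_ae ?_).trans hsum
  filter_upwards [ae_mem_sphere] with ω hω
  have hsymm : IsSymmSndFDerivAt ℝ V (x + ρ • ω, s) :=
    (hV.contDiffAt (hΩ.mem_nhds (hs ω hω))).isSymmSndFDerivAt (by simp)
  let H := fderiv ℝ (fderiv ℝ V) (x + ρ • ω, s)
  let J := ContinuousLinearMap.inl ℝ (E 3) ℝ
  exact (sum_rotationGenerator (H.bilinearComp J J) (fun v w => hsymm.eq _ _)
    ((fderiv ℝ V (x + ρ • ω, s)).comp J) (fun _ => rfl) hω ρ).symm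

/-- The cone integrand `V + ρ (∂_s + ∂_r) V` differentiated along the backward characteristic. -/
theorem hasDerivAt_cone_integrand (hΩ : IsOpen Ω) (hV : ContDiffOn ℝ 2 V Ω) {x ω : E 3}
    {t ρ : ℝ} (hp : (x + ρ • ω, t - ρ) ∈ Ω) :
    HasDerivAt (fun r => V (x + r • ω, t - r) + r * fderiv ℝ V (x + r • ω, t - r) (ω, 1))
      (2 * fderiv ℝ V (x + ρ • ω, t - ρ) (ω, 0)
        + ρ * (fderiv ℝ (fderiv ℝ V) (x + ρ • ω, t - ρ) (ω, 0) (ω, 0)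
          - fderiv ℝ (fderiv ℝ V) (x + ρ • ω, t - ρ) (0, 1) (0, 1))) ρ := by
  have hγ : HasDerivAt (fun r : ℝ => (x + r • ω, t - r)) (ω, -1) ρ := by
    have h1 : HasDerivAt (fun r : ℝ => x + r • ω) ω ρ := by
      simpa using ((hasDerivAt_id ρ).smul_const ω).const_add x
    have h2 : HasDerivAt (fun r : ℝ => t - r) (-1) ρ := by
      simpa using (hasDerivAt_id ρ).const_sub t
    exact h1.prodMk h2
  have hc := hV.contDiffAt (hΩ.mem_nhds hp)
  have hV1 : HasDerivAt (fun r => V (x + r • ω, t - r))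
      (fderiv ℝ V (x + ρ • ω, t - ρ) (ω, -1)) ρ :=
    (hc.differentiableAt two_ne_zero).hasFDerivAt.comp_hasDerivAt ρ hγ
  have hV2 : HasDerivAt (fun r => fderiv ℝ V (x + r • ω, t - r))
      (fderiv ℝ (fderiv ℝ V) (x + ρ • ω, t - ρ) (ω, -1)) ρ :=
    (hasFDerivAt_fderiv hΩ hV hp).comp_hasDerivAt ρ hγ
  have hV3 : HasDerivAt (fun r => fderiv ℝ V (x + r • ω, t - r) (ω, 1))
      (fderiv ℝ (fderiv ℝ V) (x + ρ • ω, t - ρ) (ω, -1) (ω, 1)) ρ := by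
    simpa using hV2.clm_apply (hasDerivAt_const ρ ((ω, 1) : E 3 × ℝ))
  have hsymm : IsSymmSndFDerivAt ℝ V (x + ρ • ω, t - ρ) := hc.isSymmSndFDerivAt (by simp)
  have hs := hsymm.eq (ω, 0) (0, 1)
  have d1 : ((ω, -1) : E 3 × ℝ) = (ω, 0) - (0, 1) := by simp
  have d2 : ((ω, 1) : E 3 × ℝ) = (ω, 0) + (0, 1) := by simp
  refine (hV1.add ((hasDerivAt_id' ρ).mul hV3)).congr_deriv ?_
  rw [d1, d2]
  simp only [map_add, map_sub, sub_apply]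
  -- In `(∂_r - ∂_s)(∂_r + ∂_s)V` the mixed terms cancel by symmetry of the second derivative.
  linear_combination ρ * hs

end SphericalMeans

/-! ### Monotonicity along the cone and comparison with the data -/

section ConeMonotonicity

/-- Monotonicity of the spherical mean of `V + ρ (∂_s + ∂_r) V` along the backward cone. -/
theorem exists_deriv_cone_integral_nonneg {Ω : Set (E 3 × ℝ)} (hΩ : IsOpen Ω)
    {v : E 3 → ℝ → ℝ} (hV : ContDiffOn ℝ 2 (fun p : E 3 × ℝ => v p.1 p.2) Ω) {x : E 3} {t : ℝ}
    (hmem : ∀ ρ ∈ Ioo 0 t, ∀ ω ∈ Metric.sphere (0 : E 3) 1, (x + ρ • ω, t - ρ) ∈ Ω)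
    (hwave : ∀ p ∈ Ω, waveOp v p.1 p.2 ≤ 0) {ρ : ℝ} (hρ : ρ ∈ Ioo 0 t) :
    ∃ c, 0 ≤ c ∧ HasDerivAt (fun r => ∫ ω, (v (x + r • ω) (t - r)
      + r * fderiv ℝ (fun p : E 3 × ℝ => v p.1 p.2) (x + r • ω, t - r) (ω, 1))
        ∂(sphereMeasure 3)) c ρ := by
  set V : E 3 × ℝ → ℝ := fun p => v p.1 p.2
  have hpt : Continuous fun q : ℝ × E 3 => (x + q.1 • q.2, t - q.1) := by fun_prop
  have hDV : ContinuousOn (fun q : ℝ × E 3 => fderiv ℝ V (x + q.1 • q.2, t - q.1))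
      (Ioo 0 t ×ˢ Metric.sphere (0 : E 3) 1) :=
    (contDiffOn_fderiv_of_isOpen hΩ hV).continuousOn.comp hpt.continuousOn
      fun q hq => hmem q.1 hq.1 q.2 hq.2
  have hHV : ContinuousOn (fun q : ℝ × E 3 => fderiv ℝ (fderiv ℝ V) (x + q.1 • q.2, t - q.1))
      (Ioo 0 t ×ˢ Metric.sphere (0 : E 3) 1) :=
    (continuousOn_fderiv_fderiv hΩ hV).comp hpt.continuousOn
      fun q hq => hmem q.1 hq.1 q.2 hq.2
  have hslice : ContinuousOn (fun ω : E 3 => (ρ, ω)) (Metric.sphere (0 : E 3) 1) := by fun_prop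
  have hmaps : MapsTo (fun ω : E 3 => (ρ, ω)) (Metric.sphere (0 : E 3) 1)
      (Ioo 0 t ×ˢ Metric.sphere (0 : E 3) 1) := fun ω hω => ⟨hρ, hω⟩
  have hDρ : ContinuousOn (fun ω : E 3 => fderiv ℝ V (x + ρ • ω, t - ρ))
      (Metric.sphere (0 : E 3) 1) := hDV.comp hslice hmaps
  have hHρ : ContinuousOn (fun ω : E 3 => fderiv ℝ (fderiv ℝ V) (x + ρ • ω, t - ρ))
      (Metric.sphere (0 : E 3) 1) := hHV.comp hslice hmaps
  have hF' : ContinuousOn (fun q : ℝ × E 3 => 2 * fderiv ℝ V (x + q.1 • q.2, t - q.1) (q.2, 0)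
        + q.1 * (fderiv ℝ (fderiv ℝ V) (x + q.1 • q.2, t - q.1) (q.2, 0) (q.2, 0)
          - fderiv ℝ (fderiv ℝ V) (x + q.1 • q.2, t - q.1) (0, 1) (0, 1)))
      (Ioo 0 t ×ˢ Metric.sphere (0 : E 3) 1) :=
    (continuousOn_const.mul (hDV.clm_apply (by fun_prop))).add
      (continuousOn_fst.mul (((hHV.clm_apply (by fun_prop)).clm_apply (by fun_prop)).sub
        ((hHV.clm_apply (by fun_prop)).clm_apply (by fun_prop))))
  refine ⟨_, ?_, hasDerivAt_integral_of_isCompact (μ := sphereMeasure 3) (isCompact_sphere 0 1)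
    ae_mem_sphere (I := Ioo 0 t) (Ioo_mem_nhds hρ.1 hρ.2)
    (F := fun r ω => V (x + r • ω, t - r) + r * fderiv ℝ V (x + r • ω, t - r) (ω, 1)) ?_ hF'
    fun r hr ω hω => hasDerivAt_cone_integrand hΩ hV (hmem r hr ω hω)⟩
  · have hi1 := integrable_of_continuousOn_of_ae_mem (μ := sphereMeasure 3)
      (isCompact_sphere (0 : E 3) 1) ae_mem_sphere (hF'.comp hslice hmaps)
    have hlap : ContinuousOn (fun ω : E 3 => ∑ i, fderiv ℝ (fderiv ℝ V) (x + ρ • ω, t - ρ)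
        (EuclideanSpace.single i 1, 0) (EuclideanSpace.single i 1, 0))
        (Metric.sphere (0 : E 3) 1) :=
      continuousOn_finsetSum _ fun i _ =>
        (hHρ.clm_apply continuousOn_const).clm_apply continuousOn_const
    have hi2 := integrable_of_continuousOn_of_ae_mem (μ := sphereMeasure 3)
      (isCompact_sphere (0 : E 3) 1) ae_mem_sphere
      (((continuousOn_const (c := ρ)).mul (hlap.sub
        ((hHρ.clm_apply (g := fun ω => (ω, (0 : ℝ))) (by fun_prop)).clm_apply
          (g := fun ω => (ω, (0 : ℝ))) (by fun_prop)))).sub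
        ((continuousOn_const (c := (2 : ℝ))).mul
          (hDρ.clm_apply (g := fun ω => (ω, (0 : ℝ))) (by fun_prop))))
    -- Adding this vanishing integral cancels `2 V_r + ρ V_rr` and leaves the integrand `-ρ` times
    -- the wave operator.
    have hdarboux := integral_laplacian_eq_radial hΩ hV (hmem ρ hρ)
    have hadd := integral_add hi1 hi2
    simp only [Function.comp_def] at hadd
    refine le_of_le_of_eq (integral_nonneg_of_ae ?_)
      (hadd.trans ((congrArg _ hdarboux).trans (add_zero _)))
    filter_upwards [ae_mem_sphere] with ω hω
    have hp := hmem ρ hρ ω hω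
    have hw := hwave _ hp
    rw [waveOp_eq_fderiv_fderiv (hV.contDiffAt (hΩ.mem_nhds hp))] at hw
    have hρw := mul_nonpos_of_nonneg_of_nonpos hρ.1.le hw
    simp only [Pi.zero_apply, Pi.sub_apply, Pi.mul_apply, V]
    linarith
  · intro r hr
    have hs : ContinuousOn (fun ω : E 3 => (r, ω)) (Metric.sphere (0 : E 3) 1) := by fun_prop
    have hm : MapsTo (fun ω : E 3 => (r, ω)) (Metric.sphere (0 : E 3) 1)
      (Ioo 0 t ×ˢ Metric.sphere (0 : E 3) 1) := fun ω hω => ⟨hr, hω⟩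
    have h1 : ContinuousOn (fun ω : E 3 => V (x + r • ω, t - r)) (Metric.sphere (0 : E 3) 1) :=
      hV.continuousOn.comp (by fun_prop) fun ω hω => hmem r hr ω hω
    have h2 : ContinuousOn (fun ω : E 3 => fderiv ℝ V (x + r • ω, t - r))
      (Metric.sphere (0 : E 3) 1) := hDV.comp hs hm
    exact h1.add (continuousOn_const.mul (h2.clm_apply (by fun_prop)))

/-- A function with vanishing Cauchy data on `D₀` has vanishing derivative at `t = 0`. -/
theorem fderivWithin_eq_zero_of_cauchy_data {D₀ : Set (E 3)} (hD₀ : IsOpen D₀) {T : ℝ}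
    (hT : 0 < T) {V : E 3 × ℝ → ℝ} (hV : ContDiffOn ℝ 2 V (D₀ ×ˢ Icc 0 T))
    (h0 : ∀ y ∈ D₀, V (y, 0) = 0)
    (h1 : ∀ y ∈ D₀, HasDerivWithinAt (fun s => V (y, s)) 0 (Icc 0 T) 0) {y : E 3} (hy : y ∈ D₀) :
    fderivWithin ℝ V (D₀ ×ˢ Icc 0 T) (y, 0) = 0 := by
  have h0T : (0 : ℝ) ∈ Icc 0 T := left_mem_Icc.2 hT.le
  have hd : HasFDerivWithinAt V (fderivWithin ℝ V (D₀ ×ˢ Icc 0 T) (y, 0)) (D₀ ×ˢ Icc 0 T) (y, 0) :=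
    (hV.differentiableOn two_ne_zero (y, 0) ⟨hy, h0T⟩).hasFDerivWithinAt
  set L := fderivWithin ℝ V (D₀ ×ˢ Icc 0 T) (y, 0)
  -- Space directions: `V` vanishes on the slice over the open set `D₀`. The time direction is then
  -- settled by uniqueness of one-sided derivatives on `[0, T]`.
  have hspace : L.comp (ContinuousLinearMap.inl ℝ (E 3) ℝ) = 0 := by
    have hin : HasFDerivWithinAt (fun z : E 3 => (z, (0 : ℝ)))
        (ContinuousLinearMap.inl ℝ (E 3) ℝ) D₀ y :=
      (hasFDerivAt_prodMk_left y 0).hasFDerivWithinAt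
    have hmaps : MapsTo (fun z : E 3 => (z, (0 : ℝ))) D₀ (D₀ ×ˢ Icc 0 T) := fun z hz => ⟨hz, h0T⟩
    have hc := (hd.comp y hin hmaps).hasFDerivAt (hD₀.mem_nhds hy)
    have hz : HasFDerivAt (V ∘ fun z : E 3 => (z, (0 : ℝ))) (0 : E 3 →L[ℝ] ℝ) y :=
      (hasFDerivAt_const (0 : ℝ) y).congr_of_eventuallyEq
        (by filter_upwards [hD₀.mem_nhds hy] with z hz using h0 z hz)
    exact hc.unique hz
  have htime : L (0, 1) = 0 := by
    have hin : HasDerivWithinAt (fun s : ℝ => (y, s)) ((0, 1) : E 3 × ℝ) (Icc 0 T) 0 :=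
      (hasDerivWithinAt_const (0 : ℝ) (Icc 0 T) y).prodMk (hasDerivWithinAt_id (0 : ℝ) (Icc 0 T))
    have hc := hd.comp_hasDerivWithinAt (0 : ℝ) hin fun s hs => ⟨hy, hs⟩
    exact (uniqueDiffOn_Icc hT 0 h0T).eq_deriv _ hc (h1 y hy)
  ext p
  · exact DFunLike.congr_fun hspace p
  · simpa using htime

/-- Vanishing Cauchy data and `v_tt - Δ v ≤ 0` in the cone imply `v ≤ 0` at its vertex. -/
theorem nonpos_of_waveOp_nonpos {D₀ : Set (E 3)} (hD₀ : IsOpen D₀) {T : ℝ} (hT : 0 < T)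
    {v : E 3 → ℝ → ℝ} (hV : ContDiffOn ℝ 2 (fun p : E 3 × ℝ => v p.1 p.2) (D₀ ×ˢ Icc 0 T))
    (h0 : ∀ y ∈ D₀, v y 0 = 0) (h1 : ∀ y ∈ D₀, HasDerivWithinAt (v y) 0 (Icc 0 T) 0)
    (hwave : ∀ y ∈ D₀, ∀ s ∈ Ioo 0 T, waveOp v y s ≤ 0)
    {x : E 3} {t : ℝ} (ht : 0 ≤ t) (htT : t ≤ T) (hball : Metric.closedBall x t ⊆ D₀) :
    v x t ≤ 0 := by
  set V : E 3 × ℝ → ℝ := fun p => v p.1 p.2 with hVdef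
  set S := D₀ ×ˢ Icc 0 T
  have hopen : IsOpen (D₀ ×ˢ Ioo 0 T) := hD₀.prod isOpen_Ioo
  have hsub : D₀ ×ˢ Ioo 0 T ⊆ S := prod_mono Subset.rfl Ioo_subset_Icc_self
  have hx : ∀ ρ ∈ Icc 0 t, ∀ ω ∈ Metric.sphere (0 : E 3) 1, x + ρ • ω ∈ D₀ := by
    intro ρ hρ ω hω
    have hω' : ‖ω‖ = 1 := by simpa using hω
    apply hball
    simpa [norm_smul, hω', abs_of_nonneg hρ.1] using hρ.2
  have hxS : ∀ ρ ∈ Icc 0 t, ∀ ω ∈ Metric.sphere (0 : E 3) 1, (x + ρ • ω, t - ρ) ∈ S :=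
    fun ρ hρ ω hω => ⟨hx ρ hρ ω hω, by linarith [hρ.2], by linarith [hρ.1]⟩
  have hxΩ : ∀ ρ ∈ Ioo 0 t, ∀ ω ∈ Metric.sphere (0 : E 3) 1,
      (x + ρ • ω, t - ρ) ∈ D₀ ×ˢ Ioo 0 T :=
    fun ρ hρ ω hω => ⟨hx ρ ⟨hρ.1.le, hρ.2.le⟩ ω hω, by linarith [hρ.2], by linarith [hρ.1]⟩
  have hDV : ContinuousOn (fderivWithin ℝ V S) S :=
    hV.continuousOn_fderivWithin (hD₀.uniqueDiffOn.prod (uniqueDiffOn_Icc hT)) (by norm_num)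
  -- The derivative within the slab keeps `G` continuous at both ends, where the time may be `T` or
  -- `0`; for `0 < ρ < t` it is the ordinary derivative.
  let G : ℝ → ℝ := fun ρ => ∫ ω, (V (x + ρ • ω, t - ρ)
    + ρ * fderivWithin ℝ V S (x + ρ • ω, t - ρ) (ω, 1)) ∂(sphereMeasure 3)
  have hGcont : ContinuousOn G (Icc 0 t) := by
    have hpt : Continuous fun q : ℝ × E 3 => (x + q.1 • q.2, t - q.1) := by fun_prop
    have hmaps : MapsTo (fun q : ℝ × E 3 => (x + q.1 • q.2, t - q.1))
        (Icc 0 t ×ˢ Metric.sphere (0 : E 3) 1) S := fun q hq => hxS q.1 hq.1 q.2 hq.2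
    exact continuousOn_integral_of_isCompact (isCompact_sphere (0 : E 3) 1) ae_mem_sphere
      isCompact_Icc ((hV.continuousOn.comp hpt.continuousOn hmaps).add
        (continuousOn_fst.mul ((hDV.comp hpt.continuousOn hmaps).clm_apply (by fun_prop))))
  have hGderiv : ∀ ρ ∈ Ioo 0 t, ∃ c, 0 ≤ c ∧ HasDerivAt G c ρ := by
    intro ρ hρ
    obtain ⟨c, hc, hd⟩ := exists_deriv_cone_integral_nonneg hopen (hV.mono hsub) hxΩ
      (fun p hp => hwave p.1 hp.1 p.2 hp.2) hρ
    refine ⟨c, hc, hd.congr_of_eventuallyEq ?_⟩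
    filter_upwards [Ioo_mem_nhds hρ.1 hρ.2] with r hr
    refine integral_congr_ae ?_
    filter_upwards [ae_mem_sphere] with ω hω
    rw [fderivWithin_of_mem_nhds
      (mem_of_superset (hopen.mem_nhds (hxΩ r hr ω hω)) hsub)]
  have hmono : MonotoneOn G (Icc 0 t) := by
    refine monotoneOn_of_deriv_nonneg (convex_Icc 0 t) hGcont ?_ ?_
    · rw [interior_Icc]
      intro ρ hρ
      obtain ⟨c, -, hd⟩ := hGderiv ρ hρ
      exact hd.differentiableAt.differentiableWithinAt
    · rw [interior_Icc]
      intro ρ hρ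
      obtain ⟨c, hc, hd⟩ := hGderiv ρ hρ
      rwa [hd.deriv]
  have hle : G 0 ≤ G t := hmono (left_mem_Icc.2 ht) (right_mem_Icc.2 ht) ht
  have hG0 : G 0 = (sphereMeasure 3).real univ * v x t := by
    simp [G, hVdef]
  have hGt : G t = 0 := by
    refine integral_eq_zero_of_ae ?_
    filter_upwards [ae_mem_sphere] with ω hω
    have hxt := hx t (right_mem_Icc.2 ht) ω hω
    have hz := fderivWithin_eq_zero_of_cauchy_data hD₀ hT hV h0 h1 hxt
    simp only [sub_self, Pi.zero_apply, S]
    rw [hz]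
    simp [hVdef, h0 _ hxt]
  rw [hG0, hGt] at hle
  exact nonpos_of_mul_nonpos_right hle (sphereMeasure_real_univ_pos (by norm_num))

/-- By the triangle inequality, the backward cone from a point of a cone stays in that cone, so `(x,
t)` may itself serve as vertex. -/
theorem closedBall_subset_of_mem_dependenceDomain {n : ℕ} {D₀ : Set (E n)} {x : E n} {t : ℝ}
    (h : (x, t) ∈ dependenceDomain D₀) : Metric.closedBall x t ⊆ D₀ := by
  obtain ⟨x₀, t₀, -, hsub, hx⟩ := h
  intro y hy
  refine hsub y ?_
  simp only [backwardCone, mem_ofPred_eq] at hx ⊢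
  rw [mem_closedBall_iff_norm] at hy
  have := norm_sub_le_norm_sub_add_norm_sub y x x₀
  linarith

/-- The subtracted function is affine in time, so only its Laplacian survives, with a plus sign.
This is where the sign condition on the data enters. -/
theorem waveOp_sub_affine_in_time {u : E 3 → ℝ → ℝ} {φ₀ φ₁ : E 3 → ℝ} {x : E 3} {t : ℝ}
    (hu : ContDiffAt ℝ 2 (fun p : E 3 × ℝ => u p.1 p.2) (x, t)) (h₀ : ContDiffAt ℝ 2 φ₀ x)
    (h₁ : ContDiffAt ℝ 2 φ₁ x) :
    waveOp (fun y s => u y s - (φ₀ y + s * φ₁ y)) x t =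
      waveOp u x t + (Laplacian.laplacian φ₀ x + t * Laplacian.laplacian φ₁ x) := by
  have hut : ContDiffAt ℝ 2 (fun s => u x s) t :=
    hu.comp t (f := fun s => (x, s)) (by fun_prop)
  have hux : ContDiffAt ℝ 2 (fun y => u y t) x :=
    hu.comp x (f := fun y => (y, t)) (by fun_prop)
  have htime : iteratedDeriv 2 (fun s => φ₀ x + s * φ₁ x) t = 0 := by
    have : deriv (fun s : ℝ => φ₀ x + s * φ₁ x) = fun _ => φ₁ x := by
      ext s
      simpa only [id, one_mul] using (((hasDerivAt_id s).mul_const (φ₁ x)).const_add (φ₀ x)).deriv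
    rw [iteratedDeriv_succ, iteratedDeriv_one, this, deriv_const]
  have hspace : Laplacian.laplacian ((fun y => u y t) - (φ₀ + t • φ₁)) x =
      Laplacian.laplacian (fun y => u y t) x
        - (Laplacian.laplacian φ₀ x + t * Laplacian.laplacian φ₁ x) := by
    have ht₁ : ContDiffAt ℝ 2 (t • φ₁) x := h₁.const_smul t
    have hsum : ContDiffAt ℝ 2 (φ₀ + t • φ₁) x := h₀.add ht₁
    rw [hux.laplacian_sub hsum, h₀.laplacian_add ht₁,
      InnerProductSpace.laplacian_smul t h₁, smul_eq_mul]
  unfold waveOp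
  rw [iteratedDeriv_fun_sub (n := 2) hut (by fun_prop), htime]
  have hfun : (fun y => u y t - (φ₀ y + t * φ₁ y)) = (fun y => u y t) - (φ₀ + t • φ₁) := rfl
  rw [hfun, hspace]
  ring

/-- Comparison with superharmonic Cauchy data. -/
theorem le_of_superharmonic_data {T : ℝ} {D₀ : Set (E 3)} (hD₀ : IsOpen D₀)
    {u : E 3 → ℝ → ℝ} {φ₀ φ₁ : E 3 → ℝ}
    (hu : ContDiffOn ℝ 2 (fun p : E 3 × ℝ => u p.1 p.2) (univ ×ˢ Icc 0 T))
    (hinit : HasInitialValues T u φ₀ φ₁ D₀)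
    (hwave : ∀ x, ∀ t ∈ Ioo 0 T, waveOp u x t ≤ 0)
    (hφ₀ : C2Superharmonic φ₀ D₀) (hφ₁ : C2Superharmonic φ₁ D₀) {x : E 3} {t : ℝ}
    (hx : (x, t) ∈ dependenceDomain D₀) (ht : 0 ≤ t) (htT : t ≤ T) :
    u x t ≤ φ₀ x + t * φ₁ x := by
  have hball := closedBall_subset_of_mem_dependenceDomain hx
  -- At `t = 0` the claim is the initial condition. Otherwise `0 < t ≤ T` supplies `0 < T`, without
  -- which one-sided time derivatives are not unique.
  rcases ht.eq_or_lt with rfl | ht0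
  · simp [(hinit x (hball (by simp))).1]
  have hT : 0 < T := ht0.trans_le htT
  have hφ : ∀ {φ : E 3 → ℝ}, ContDiffOn ℝ 2 φ D₀ →
      ContDiffOn ℝ 2 (fun p : E 3 × ℝ => φ p.1) (D₀ ×ˢ Icc 0 T) := fun h =>
    h.comp contDiff_fst.contDiffOn fun p hp => hp.1
  refine sub_nonpos.1 (nonpos_of_waveOp_nonpos hD₀ hT
    (v := fun y s => u y s - (φ₀ y + s * φ₁ y)) ?_ ?_ ?_ ?_ ht htT hball)
  · exact (hu.mono (prod_mono (subset_univ _) Subset.rfl)).sub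
      ((hφ hφ₀.1).add (contDiff_snd.contDiffOn.mul (hφ hφ₁.1)))
  · intro y hy
    simp [(hinit y hy).1]
  · intro y hy
    refine ((hinit y hy).2.sub
      ((((hasDerivAt_id (0 : ℝ)).mul_const (φ₁ y)).const_add (φ₀ y)).hasDerivWithinAt
        (s := Icc 0 T))).congr_deriv ?_
    simp
  · intro y hy s hs
    rw [waveOp_sub_affine_in_time
      (hu.contDiffAt (prod_mem_nhds univ_mem (Icc_mem_nhds hs.1 hs.2)))
      (hφ₀.1.contDiffAt (hD₀.mem_nhds hy)) (hφ₁.1.contDiffAt (hD₀.mem_nhds hy))]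
    linarith [hwave y s hs, hφ₀.2 y hy, mul_nonpos_of_nonneg_of_nonpos hs.1.le (hφ₁.2 y hy)]

theorem waveOp_neg {n : ℕ} (u : E n → ℝ → ℝ) (x : E n) (t : ℝ) :
    waveOp (fun y s => -u y s) x t = -waveOp u x t := by
  have h1 := iteratedDeriv_neg 2 (fun s => u x s) t
  have h2 := congrFun (InnerProductSpace.laplacian_neg (f := fun y => u y t)) x
  unfold waveOp
  change iteratedDeriv 2 (-fun s => u x s) t - Laplacian.laplacian (-fun y => u y t) x = _
  rw [h1, h2, Pi.neg_apply]
  ring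

theorem C2Subharmonic.neg {n : ℕ} {φ : E n → ℝ} {D : Set (E n)} (h : C2Subharmonic φ D) :
    C2Superharmonic (-φ) D := by
  refine ⟨h.1.neg, fun x hx => ?_⟩
  rw [InnerProductSpace.laplacian_neg, Pi.neg_apply]
  exact neg_nonpos.2 (h.2 x hx)

end ConeMonotonicity

end WaveMax

end

/-- `u` is `C²` on the closed slab `ℝ³ × [0, T]`. The differential inequality is only required
for `0 < t < T`; by continuity of the second derivatives this is the same as for `0 ≤ t ≤ T`. -/
theorem mainTheorem6 (T : ℝ) (D₀ : Set (WaveMax.E 3)) (hD₀ : IsOpen D₀)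
    (u : WaveMax.E 3 → ℝ → ℝ) (φ₀ φ₁ : WaveMax.E 3 → ℝ)
    (hu : ContDiffOn ℝ 2 (fun p : WaveMax.E 3 × ℝ => u p.1 p.2) (Set.univ ×ˢ Set.Icc 0 T))
    (hinit : WaveMax.HasInitialValues T u φ₀ φ₁ D₀) :
    ((∀ x : WaveMax.E 3, ∀ t ∈ Set.Ioo 0 T, WaveMax.waveOp u x t ≤ 0) →
      WaveMax.C2Superharmonic φ₀ D₀ → WaveMax.C2Superharmonic φ₁ D₀ →
      ∀ (x : WaveMax.E 3) (t : ℝ), (x, t) ∈ WaveMax.dependenceDomain D₀ → 0 ≤ t → t ≤ T →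
        u x t ≤ φ₀ x + t * φ₁ x) ∧
    ((∀ x : WaveMax.E 3, ∀ t ∈ Set.Ioo 0 T, 0 ≤ WaveMax.waveOp u x t) →
      WaveMax.C2Subharmonic φ₀ D₀ → WaveMax.C2Subharmonic φ₁ D₀ →
      ∀ (x : WaveMax.E 3) (t : ℝ), (x, t) ∈ WaveMax.dependenceDomain D₀ → 0 ≤ t → t ≤ T →
        φ₀ x + t * φ₁ x ≤ u x t) := by
  refine ⟨fun hw h₀ h₁ x t hx ht htT =>
    WaveMax.le_of_superharmonic_data hD₀ hu hinit hw h₀ h₁ hx ht htT,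
    fun hw h₀ h₁ x t hx ht htT => ?_⟩
  -- Negation exchanges the two cases.
  have h := WaveMax.le_of_superharmonic_data (u := fun y s => -u y s) (φ₀ := -φ₀) (φ₁ := -φ₁)
    hD₀ hu.neg (fun y hy => ⟨by simp [(hinit y hy).1], (hinit y hy).2.neg⟩)
    (fun y s hs => by
      rw [WaveMax.waveOp_neg]
      exact neg_nonpos.2 (hw y s hs)) h₀.neg h₁.neg hx ht htT
  simp only [Pi.neg_apply] at h
  linarith
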